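/- Let $\mathbb{K}$ be a field of characteristic zero, $V=\mathbb{K}^{\ell+1}$ with $\ell\ge 2$, $S=\mathbb{K}[x_0,\dots,x_\ell]$, and let $\alpha_1,\dots,\alpha_n\in V^*$ be nonzero linear forms defining $n$ distinct hyperplanes $H_i=\mathbb{V}(\alpha_i)$ of an arrangement $\mathcal{A}$ in $\mathbb{P}^\ell$. Put $Q=\prod_{i=1}^n\alpha_i$, let $J_{\mathcal A}=\langle \partial Q/\partial x_0,\dots,\partial Q/\partial x_\ell\rangle\subseteq S$ be the Jacobian ideal, and let $J^{[k]}_{\mathcal A}$ be its codimension-$k$ saturation, i.e. the intersection of those primary components of $J_{\mathcal A}$ (in a minimal primary decomposition) whose associated prime has height at most $k$ (the empty intersection being $S$). Let $\mathcal{M}(\alpha)$ be the linear matroid of $\alpha_1,\dots,\alpha_n$ and, for $r\ge 1$, let $\mathcal{M}(\alpha)^{[r]}$ be its truncation, whose independent sets are the independent sets of $\mathcal{M}(\alpha)$ with at most $r$ elements. A hyperplane $H_0=\mathbb{V}(\alpha_0)\subset\mathbb{P}^\ell$ is in rank $r$ general linear position with respect to $\mathcal{A}$ if no nonempty intersection $\bigcap_{i\in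 F}H_i\subseteq\mathbb{P}^\ell$, for $F$ a flat of $\mathcal{M}(\alpha)$ of rank at most $r$, is contained in $H_0$. For such an $H_0$, a map $\beta:\{1,\dots,n\}\to V^*$ is a weak perspective representation of $\mathcal{M}(\alpha)$ from $H_0$ up to rank $r$ if $\beta_1,\dots,\beta_n$ define $n$ distinct hyperplanes, $H_0$ is none of the hyperplanes $\mathbb{V}(\alpha_i)$, $\mathbb{V}(\beta_i)$, one has $\mathbb{V}(\alpha_i)\cap H_0=\mathbb{V}(\beta_i)\cap H_0$ for all $i$, and every dependent set of $\mathcal{M}(\alpha)^{[r]}$ is dependent in $\mathcal{M}(\beta)^{[r]}$. **Theorem.** Let $1\le k\le \ell$ and let $H_0=\mathbb{V}(\alpha_0)$ be a hyperplane in rank $k+1$ general linear position with respect to $\mathcal{A}$. For $\lambda_1,\dots,\lambda_n\in\mathbb{K}$ put $$f=\sum_{i=1}^n\lambda_i\frac{Q}{\alpha_i},\qquad \beta_i=\alpha_i+\lambda_i\alpha_0\quad(1\le i\le n).$$ Then $f\in J^{[k]}_{\mathcal A}$ if and only if $\beta$ is a weak perspective representation of $\mathcal{M}(\alpha)$ from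 $H_0$ up to rank $k+1$. -/

import Mathlib

namespace WeakPRep

/-- The hyperplanes `V(α 0), …, V(α (n-1))` are honest hyperplanes and pairwise distinct, so that the
linear forms `α` define an arrangement of `n` hyperplanes in `ℙ^ℓ`. -/
def IsArrangement {K : Type*} [Field K] {ℓ n : ℕ}
    (α : Fin n → Module.Dual K (Fin (ℓ + 1) → K)) : Prop :=
  (∀ i, α i ≠ 0) ∧ ∀ i j, i ≠ j → LinearMap.ker (α i) ≠ LinearMap.ker (α j)

/-! ### The linear matroid `M(α)`, its flats and its truncations -/

/-- `s` is an independent set of the rank `r` truncation `M(α)^[r]` of the linear matroid `M(α)`. -/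
def TruncIndep {K : Type*} [Field K] {ℓ n : ℕ}
    (α : Fin n → Module.Dual K (Fin (ℓ + 1) → K)) (r : ℕ) (s : Finset (Fin n)) : Prop :=
  s.card ≤ r ∧ LinearIndepOn K α (s : Set (Fin n))

/-- `β` is a weak representation of the matroid `M(α)` up to rank `r`: in the weak order,
`M(α)^[r] ≥ M(β)^[r]`, that is, every dependent set of `M(α)^[r]` is dependent in `M(β)^[r]`. -/
def IsWeakRep {K : Type*} [Field K] {ℓ n : ℕ}
    (α : Fin n → Module.Dual K (Fin (ℓ + 1) → K)) (r : ℕ)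
    (β : Fin n → Module.Dual K (Fin (ℓ + 1) → K)) : Prop :=
  ∀ s : Finset (Fin n), ¬ TruncIndep α r s → ¬ TruncIndep β r s

/-- `F` is a flat (closed set) of the matroid `M(α)`. -/
def IsFlat {K : Type*} [Field K] {ℓ n : ℕ}
    (α : Fin n → Module.Dual K (Fin (ℓ + 1) → K)) (F : Set (Fin n)) : Prop :=
  ∀ j, α j ∈ Submodule.span K (α '' F) → j ∈ F

/-- The rank of a set in the matroid `M(α)`. -/
noncomputable def rank {K : Type*} [Field K] {ℓ n : ℕ}
    (α : Fin n → Module.Dual K (Fin (ℓ + 1) → K)) (F : Set (Fin n)) : ℕ :=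
  Module.finrank K (Submodule.span K (α '' F))

/-- The linear subspace of `K^(ℓ+1)` whose projectivization is the intersection of the hyperplanes
`V(α i)`, `i ∈ F`. -/
def zeroSpace {K : Type*} [Field K] {ℓ n : ℕ}
    (α : Fin n → Module.Dual K (Fin (ℓ + 1) → K)) (F : Set (Fin n)) :
    Submodule K (Fin (ℓ + 1) → K) :=
  ⨅ i ∈ F, LinearMap.ker (α i)

/-- `H₀ = V(α₀)` is in rank `r` general linear position with respect to `𝒜(α)`: no flat of rank at
most `r` which is nonempty as a subset of `ℙ^ℓ` is contained in `H₀`. -/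
def IsGenLinPos {K : Type*} [Field K] {ℓ n : ℕ}
    (α : Fin n → Module.Dual K (Fin (ℓ + 1) → K)) (r : ℕ)
    (α₀ : Module.Dual K (Fin (ℓ + 1) → K)) : Prop :=
  ∀ F : Set (Fin n), IsFlat α F → rank α F ≤ r → zeroSpace α F ≠ ⊥ →
    ¬ zeroSpace α F ≤ LinearMap.ker α₀

/-- `α` and `β` are perspective from `H₀ = V(α₀)`: `H₀` belongs to neither arrangement and both
arrangements have the same restriction to `H₀`. -/
def IsPerspective {K : Type*} [Field K] {ℓ n : ℕ}
    (α : Fin n → Module.Dual K (Fin (ℓ + 1) → K))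
    (α₀ : Module.Dual K (Fin (ℓ + 1) → K))
    (β : Fin n → Module.Dual K (Fin (ℓ + 1) → K)) : Prop :=
  (∀ i, LinearMap.ker (α i) ≠ LinearMap.ker α₀) ∧
  (∀ i, LinearMap.ker (β i) ≠ LinearMap.ker α₀) ∧
  ∀ i, LinearMap.ker (α i) ⊓ LinearMap.ker α₀ = LinearMap.ker (β i) ⊓ LinearMap.ker α₀

/-- `β` defines a weak perspective representation of `M(α)` from `H₀ = V(α₀)` up to rank `r`. -/
def IsWeakPRepFrom {K : Type*} [Field K] {ℓ n : ℕ}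
    (α : Fin n → Module.Dual K (Fin (ℓ + 1) → K)) (r : ℕ)
    (α₀ : Module.Dual K (Fin (ℓ + 1) → K))
    (β : Fin n → Module.Dual K (Fin (ℓ + 1) → K)) : Prop :=
  IsArrangement β ∧ IsGenLinPos α r α₀ ∧ IsPerspective α α₀ β ∧ IsWeakRep α r β

/-! ### The defining polynomial, the Jacobian ideal and its saturations -/

/-- A linear form on `K^(ℓ+1)` as an element of `K[x_0, …, x_ℓ]`. -/
noncomputable def formPoly {K : Type*} [Field K] {ℓ : ℕ}
    (φ : Module.Dual K (Fin (ℓ + 1) → K)) : MvPolynomial (Fin (ℓ + 1)) K :=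
  ∑ j, MvPolynomial.C (φ (Pi.single j 1)) * MvPolynomial.X j

/-- The defining polynomial `Q = ∏ α_i`. -/
noncomputable def definingPoly {K : Type*} [Field K] {ℓ n : ℕ}
    (α : Fin n → Module.Dual K (Fin (ℓ + 1) → K)) : MvPolynomial (Fin (ℓ + 1)) K :=
  ∏ i, formPoly (α i)

/-- The quotient `Q / α_i`, the product of all the other forms. -/
noncomputable def definingPolyDiv {K : Type*} [Field K] {ℓ n : ℕ}
    (α : Fin n → Module.Dual K (Fin (ℓ + 1) → K)) (i : Fin n) :
    MvPolynomial (Fin (ℓ + 1)) K :=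
  ∏ j ∈ Finset.univ.erase i, formPoly (α j)

theorem formPoly_mul_definingPolyDiv {K : Type*} [Field K] {ℓ n : ℕ}
    (α : Fin n → Module.Dual K (Fin (ℓ + 1) → K)) (i : Fin n) :
    formPoly (α i) * definingPolyDiv α i = definingPoly α :=
  Finset.mul_prod_erase Finset.univ (fun j => formPoly (α j)) (Finset.mem_univ i)

/-- The Jacobian ideal, generated by the partial derivatives of `Q`. -/
noncomputable def jacobianIdeal {K : Type*} [Field K] {ℓ n : ℕ}
    (α : Fin n → Module.Dual K (Fin (ℓ + 1) → K)) : Ideal (MvPolynomial (Fin (ℓ + 1)) K) :=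
  Ideal.span (Set.range fun j => MvPolynomial.pderiv j (definingPoly α))

/-- The codimension-`k` saturation `I^[k]`: the intersection of the primary components of `I` whose
associated prime has height at most `k`. Here a primary component is a member of a minimal primary
decomposition of `I`; by `codimSaturation_eq` any one decomposition gives the same ideal. -/
def codimSaturation {R : Type*} [CommRing R] (k : ℕ) (I : Ideal R) : Ideal R :=
  ⨅ (t : Finset (Ideal R)) (_ : Submodule.IsMinimalPrimaryDecomposition I t)
    (q : Ideal R) (_ : q ∈ t) (_ : q.radical.height ≤ k), q

theorem codimSaturation_eq {R : Type*} [CommRing R] (k : ℕ) (I : Ideal R)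
    (t : Finset (Ideal R)) (ht : Submodule.IsMinimalPrimaryDecomposition I t) :
    codimSaturation k I = ⨅ q ∈ t, ⨅ _ : q.radical.height ≤ k, q := by
  classical
  have hcol : ∀ q : Ideal R, (Submodule.colon q Set.univ).radical = q.radical := by
    intro q
    congr 1
    ext x
    simp only [Submodule.mem_colon, Set.mem_univ, smul_eq_mul, forall_const]
    exact ⟨fun h => by simpa using h 1, fun h y => q.mul_mem_right y h⟩
  have fin : ∀ t : Finset (Ideal R), Submodule.IsMinimalPrimaryDecomposition I t →
      (Submodule.associatedPrimes I).Finite := by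
    intro t ht
    rw [← ht.image_radical_eq_associated_primes]
    exact t.finite_toSet.image _
  have : Finite (Submodule.associatedPrimes I) := fin t ht
  have := Fintype.ofFinite (Submodule.associatedPrimes I)
  set s₀ : Finset (Submodule.associatedPrimes I) :=
    Finset.univ.filter (fun p => p.1.height ≤ k) with hs₀def
  have hs₀ : IsLowerSet (s₀ : Set (Submodule.associatedPrimes I)) := by
    intro a b hab ha
    simp only [hs₀def, Finset.coe_filter, Finset.mem_univ, true_and, Set.mem_ofPred_eq] at ha ⊢
    exact (Ideal.height_mono hab).trans ha
  have key : ∀ t : Finset (Ideal R), Submodule.IsMinimalPrimaryDecomposition I t →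
      (⨅ q ∈ t, ⨅ _ : q.radical.height ≤ k, q) =
        (I.localized₀ (⨅ q ∈ s₀, q.1.primeCompl)
          (LocalizedModule.mkLinearMap (⨅ q ∈ s₀, q.1.primeCompl) R)).comap
          (LocalizedModule.mkLinearMap (⨅ q ∈ s₀, q.1.primeCompl) R) := by
    intro t ht
    rw [ht.comap_localized₀_eq_iInf s₀ hs₀ (t.filter fun q => (Ideal.radical q).height ≤ k)
      (Finset.filter_subset _ _)]
    · simp only [Finset.mem_filter, iInf_and]
    · ext p
      simp only [Finset.mem_image, Finset.mem_filter, hs₀def, Finset.mem_univ, true_and]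
      constructor
      · rintro ⟨q, ⟨hq, hk⟩, rfl⟩
        refine ⟨⟨_, ht.mem_associatedPrimes hq⟩, ?_, rfl⟩
        simpa only [hcol] using hk
      · rintro ⟨⟨p, hp⟩, hk, rfl⟩
        have hp' := hp
        rw [← ht.image_radical_eq_associated_primes] at hp'
        obtain ⟨q, hq, hqp⟩ := hp'
        refine ⟨q, ⟨hq, ?_⟩, hqp⟩
        rw [← hcol q]
        simp only at hqp hk
        rw [hqp]
        exact hk
  unfold codimSaturation
  refine le_antisymm (iInf₂_le t ht) (le_iInf₂ fun t' ht' => ?_)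
  rw [key t ht, ← key t' ht']

end WeakPRep

/-!
# Saturations of the Jacobian ideal and weak perspective representations

Write `f = ∑ c_i Q / α_i`. Membership `f ∈ J^[k]` is local: it says that `f` lies in `J` after
localization at every prime of height at most `k` (`mem_codimSaturation_iff`). Such a prime `P` only
matters through the forms `α_i ∈ P`: they span a space `W` of dimension at most `k`, because the
ideal `formIdeal W` generated by a `d`-dimensional space of linear forms is a prime of height `d`
(`height_formIdeal_le`, `finrank_span_le_height_formIdeal`). The outcome is the linear criterion
`mem_codimSaturation_jacobianIdeal_iff`: `f ∈ J^[k]` if and only if on every set `F` of rank at most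
`k` the scalars `c_i` are the values `α_i(v)` of the forms at one vector `v`.

* If `c_i = α_i(v)` for all `α_i ∈ P`, then `f` differs from the directional derivative
  `D_v Q = ∑ α_i(v) Q / α_i ∈ J` by multiples of `Q / α_i` with `α_i ∉ P`. The product of the forms
  outside `P` carries these into `(Q)`, and `Q ∈ J` by Euler's identity in characteristic zero.
* Conversely, let `g f = ∑ h_j ∂_j Q` with `g` not vanishing at some point `p` of the subspace
  `⋂_{i ∈ F} ker α_i`. This is a relation `∑ B_i Q / α_i = 0` with
  `B_i = ∑ h_j α_i(e_j) - g c_i`. Each `B_i` is divisible by `α_i`, as `α_i` is coprime to the other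
  forms, so for `i ∈ F` it vanishes at `p`, and `v = h(p) / g(p)` works
  (`exists_eq_apply_of_mul_mem_jacobianIdeal`).

The rest is linear algebra. If `c_i = α_i(v)` on `F`, then `β_i = T α_i` there, for the linear map
`T φ = φ + φ(v) α₀`, so dependencies of `α` pass to `β`. If conversely `β` is a weak representation,
choose a basis `B` of `F` and `v` with `α_i(v) = c_i` on `B`. General position says `α₀ ∉ span F`,
so `T` is injective on that span. For `j ∈ F \ B` the set `B ∪ {j}` has at most `k + 1` elements and
is dependent, hence `β_j ∈ T (span B)`, and comparing the coefficients of `α₀` gives `c_j = α_j(v)`.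
-/

open MvPolynomial Module

namespace WeakPRep

/-! ### Codimension-`k` saturations through localization -/

/-- The codimension-`k` saturation consists of the elements lying in `I` locally at every prime of
height at most `k`. -/
theorem mem_codimSaturation_iff {R : Type*} [CommRing R] [IsNoetherianRing R] (k : ℕ)
    (I : Ideal R) (f : R) :
    f ∈ codimSaturation k I ↔
      ∀ P : Ideal R, P.IsPrime → P.height ≤ k → ∃ g, g ∉ P ∧ g * f ∈ I := by
  obtain ⟨t, ht⟩ := Submodule.IsLasker.exists_isMinimalPrimaryDecomposition
    (Submodule.isLasker R R) I
  have hI : ∀ x, x ∈ I ↔ ∀ q ∈ t, x ∈ q := fun x => by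
    rw [← ht.inf_eq, Finset.inf_id_eq_sInf, Submodule.mem_sInf]
    simp
  rw [codimSaturation_eq k I t ht]
  simp only [Submodule.mem_iInf]
  constructor
  · intro hf P hP hPk
    -- A component inside `P` contains `f`; any other component has an element outside `P`.
    have hg : ∀ q ∈ t, ∃ g, g ∉ P ∧ g * f ∈ q := by
      intro q hq
      by_cases hqP : q ≤ P
      · refine ⟨1, (Ideal.ne_top_iff_one P).mp hP.ne_top, ?_⟩
        rw [one_mul]
        exact hf q hq ((Ideal.height_mono (hP.radical_le_iff.mpr hqP)).trans hPk)
      · obtain ⟨g, hgq, hgP⟩ := SetLike.not_le_iff_exists.mp hqP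
        exact ⟨g, hgP, Ideal.mul_mem_right f q hgq⟩
    choose! g hgP hgf using hg
    refine ⟨∏ q ∈ t, g q, fun h => ?_, (hI _).mpr fun q hq => ?_⟩
    · obtain ⟨q, hq, hqP⟩ := hP.prod_mem_iff.mp h
      exact hgP q hq hqP
    · obtain ⟨r, hr⟩ := Finset.dvd_prod_of_mem g hq
      rw [hr, mul_right_comm]
      exact Ideal.mul_mem_right r q (hgf q hq)
  · intro h q hq hqk
    have hprim : q.IsPrimary := ht.primary hq
    obtain ⟨g, hg, hgf⟩ := h q.radical (Ideal.isPrime_radical hprim) hqk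
    have := (hI _).mp hgf q hq
    rw [mul_comm] at this
    exact ((Ideal.isPrimary_iff.mp hprim).2 this).resolve_right hg

/-! ### Ideals generated by linear forms -/

section Forms

variable {K : Type*} [Field K] {ℓ : ℕ}

theorem dual_apply_eq_sum (φ : Dual K (Fin (ℓ + 1) → K)) (x : Fin (ℓ + 1) → K) :
    φ x = ∑ j, φ (Pi.single j 1) * x j := by
  conv_lhs => rw [← Finset.univ_sum_single x, map_sum]
  refine Finset.sum_congr rfl fun j _ => ?_
  rw [mul_comm, ← smul_eq_mul, ← map_smul, ← Pi.single_smul, smul_eq_mul, mul_one]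

@[simp]
theorem eval_formPoly (φ : Dual K (Fin (ℓ + 1) → K)) (x : Fin (ℓ + 1) → K) :
    eval x (formPoly φ) = φ x := by
  simp [formPoly, dual_apply_eq_sum φ x]

theorem formPoly_sub (φ ψ : Dual K (Fin (ℓ + 1) → K)) :
    formPoly (φ - ψ) = formPoly φ - formPoly ψ := by
  simp [formPoly, sub_mul]

theorem formPoly_add (φ ψ : Dual K (Fin (ℓ + 1) → K)) :
    formPoly (φ + ψ) = formPoly φ + formPoly ψ := by
  simp [formPoly, add_mul, Finset.sum_add_distrib]

theorem formPoly_smul (a : K) (φ : Dual K (Fin (ℓ + 1) → K)) :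
    formPoly (a • φ) = C a * formPoly φ := by
  simp [formPoly, Finset.mul_sum, mul_assoc]

theorem formPoly_proj (j : Fin (ℓ + 1)) :
    formPoly (LinearMap.proj j : Dual K (Fin (ℓ + 1) → K)) = X j := by
  simp [formPoly, Pi.single_apply]

/-- The ideal of polynomials generated by a space `W` of linear forms, that is, the ideal of the
linear subspace `W.dualCoannihilator` on which all forms of `W` vanish. -/
noncomputable def formIdeal (W : Submodule K (Dual K (Fin (ℓ + 1) → K))) :
    Ideal (MvPolynomial (Fin (ℓ + 1)) K) :=
  Ideal.span (formPoly '' W)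

theorem formPoly_mem_formIdeal {W : Submodule K (Dual K (Fin (ℓ + 1) → K))}
    {φ : Dual K (Fin (ℓ + 1) → K)} (h : φ ∈ W) : formPoly φ ∈ formIdeal W :=
  Ideal.subset_span ⟨φ, h, rfl⟩

theorem formIdeal_span_le_iff {s : Set (Dual K (Fin (ℓ + 1) → K))}
    {I : Ideal (MvPolynomial (Fin (ℓ + 1)) K)} :
    formIdeal (Submodule.span K s) ≤ I ↔ ∀ φ ∈ s, formPoly φ ∈ I := by
  refine ⟨fun h φ hφ => h (formPoly_mem_formIdeal (Submodule.subset_span hφ)), fun h => ?_⟩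
  rw [formIdeal, Ideal.span_le]
  rintro _ ⟨φ, hφ, rfl⟩
  induction hφ using Submodule.span_induction with
  | mem x hx => exact h x hx
  | zero => simp [formPoly]
  | add x y _ _ hx hy => rw [formPoly_add]; exact I.add_mem hx hy
  | smul a x _ hx => rw [formPoly_smul]; exact I.mul_mem_left _ hx

/-- Substitution `θ g = g ∘ π` of a linear projection `π` onto the zero space of `W`. It is the
identity modulo `formIdeal W` since each coordinate form `x_j - x_j ∘ π` vanishes on that zero
space. -/
theorem exists_algHom_formIdeal (W : Submodule K (Dual K (Fin (ℓ + 1) → K))) :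
    ∃ θ : MvPolynomial (Fin (ℓ + 1)) K →ₐ[K] MvPolynomial (Fin (ℓ + 1)) K,
      (∀ g, g - θ g ∈ formIdeal W) ∧
        ∀ g x, ∃ y ∈ W.dualCoannihilator, eval x (θ g) = eval y g := by
  obtain ⟨f, hf⟩ := LinearMap.exists_leftInverse_of_injective W.dualCoannihilator.subtype
    (Submodule.ker_subtype _)
  set π := W.dualCoannihilator.subtype ∘ₗ f with hπ
  refine ⟨aeval fun j => formPoly (LinearMap.proj j ∘ₗ π), fun g => ?_, fun g x => ?_⟩
  · have key : (Ideal.Quotient.mkₐ K (formIdeal W)).comp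
        (aeval fun j => formPoly (LinearMap.proj j ∘ₗ π)) =
          Ideal.Quotient.mkₐ K (formIdeal W) := by
      refine algHom_ext fun j => ?_
      rw [AlgHom.comp_apply, aeval_X, Ideal.Quotient.mkₐ_eq_mk, eq_comm,
        Ideal.Quotient.mk_eq_mk_iff_sub_mem,
        ← formPoly_proj, ← formPoly_sub]
      apply formPoly_mem_formIdeal
      rw [← Subspace.dualCoannihilator_dualAnnihilator_eq (W := W),
        Submodule.mem_dualAnnihilator]
      intro w hw
      have : f w = ⟨w, hw⟩ := LinearMap.congr_fun hf ⟨w, hw⟩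
      simp [hπ, this]
    have := AlgHom.congr_fun key g
    rw [AlgHom.comp_apply, Ideal.Quotient.mkₐ_eq_mk, eq_comm,
      Ideal.Quotient.mk_eq_mk_iff_sub_mem] at this
    exact this
  · refine ⟨π x, (f x).2, ?_⟩
    rw [← coe_aeval_eq_eval, ← coe_aeval_eq_eval]
    change ((aeval x).comp (aeval _)) g = aeval (π x) g
    congr 1
    refine algHom_ext fun j => ?_
    simp

theorem eval_eq_zero_of_mem_formIdeal {W : Submodule K (Dual K (Fin (ℓ + 1) → K))}
    {g : MvPolynomial (Fin (ℓ + 1)) K} (hg : g ∈ formIdeal W) {x : Fin (ℓ + 1) → K}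
    (hx : x ∈ W.dualCoannihilator) : eval x g = 0 := by
  suffices formIdeal W ≤ RingHom.ker (eval x) from this hg
  rw [formIdeal, Ideal.span_le]
  rintro _ ⟨φ, hφ, rfl⟩
  simpa using (Submodule.mem_dualCoannihilator x).mp hx φ hφ

theorem formPoly_mem_formIdeal_iff {W : Submodule K (Dual K (Fin (ℓ + 1) → K))}
    {φ : Dual K (Fin (ℓ + 1) → K)} : formPoly φ ∈ formIdeal W ↔ φ ∈ W := by
  refine ⟨fun h => ?_, formPoly_mem_formIdeal⟩
  rw [← Subspace.dualCoannihilator_dualAnnihilator_eq (W := W), Submodule.mem_dualAnnihilator]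
  intro x hx
  simpa using eval_eq_zero_of_mem_formIdeal h hx

variable [Infinite K]

/-- The Nullstellensatz for linear subspaces, over any infinite field. -/
theorem mem_formIdeal_iff {W : Submodule K (Dual K (Fin (ℓ + 1) → K))}
    {g : MvPolynomial (Fin (ℓ + 1)) K} :
    g ∈ formIdeal W ↔ ∀ x ∈ W.dualCoannihilator, eval x g = 0 := by
  refine ⟨fun hg x hx => eval_eq_zero_of_mem_formIdeal hg hx, fun h => ?_⟩
  obtain ⟨θ, hθ, hθe⟩ := exists_algHom_formIdeal W
  have h0 : θ g = 0 := MvPolynomial.funext fun x => by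
    obtain ⟨y, hy, hxy⟩ := hθe g x
    rw [hxy, h y hy, map_zero]
  simpa [h0] using hθ g

instance formIdeal_isPrime (W : Submodule K (Dual K (Fin (ℓ + 1) → K))) :
    (formIdeal W).IsPrime := by
  obtain ⟨θ, hθ, hθe⟩ := exists_algHom_formIdeal W
  -- `formIdeal W` is the kernel of the substitution `θ` into a domain.
  have : formIdeal W = RingHom.ker θ := by
    ext g
    refine ⟨fun hg => MvPolynomial.funext fun x => ?_, fun hg => ?_⟩
    · obtain ⟨y, hy, hxy⟩ := hθe g x
      rw [map_zero]
      exact hxy.trans (eval_eq_zero_of_mem_formIdeal hg hy)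
    · simpa [RingHom.mem_ker.mp hg] using hθ g
  rw [this]
  exact RingHom.ker_isPrime θ

/-- Krull's height theorem bounds the height by the number of generators. -/
theorem height_formIdeal_le (W : Submodule K (Dual K (Fin (ℓ + 1) → K))) :
    (formIdeal W).height ≤ finrank K W := by
  classical
  have : Module.Free K W := Module.Free.of_divisionRing K W
  let b := finBasis K W
  have hspan : formIdeal W = Ideal.span (Set.range fun i => formPoly (b i : Dual K _)) := by
    apply le_antisymm
    · have hW : Submodule.span K (Set.range fun i => (b i : Dual K (Fin (ℓ + 1) → K))) = W := by
        rw [show (Set.range fun i => (b i : Dual K (Fin (ℓ + 1) → K))) =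
          W.subtype '' Set.range b from (Set.range_comp _ _), ← Submodule.map_span, b.span_eq,
          Submodule.map_subtype_top]
      conv_lhs => rw [← hW]
      rw [formIdeal_span_le_iff]
      rintro _ ⟨i, rfl⟩
      exact Ideal.subset_span ⟨i, rfl⟩
    · rw [Ideal.span_le]
      rintro _ ⟨i, rfl⟩
      exact formPoly_mem_formIdeal (b i).2
  have hmin : formIdeal W ∈
      (Ideal.span (Set.range fun i => formPoly (b i : Dual K _))).minimalPrimes := by
    rw [← hspan, Ideal.minimalPrimes_eq_subsingleton_self]
    rfl
  refine (Ideal.height_le_card_of_mem_minimalPrimes_span (Set.finite_range _) hmin).trans ?_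
  rw [← Set.image_univ]
  exact_mod_cast (Set.ncard_image_le Set.finite_univ).trans (by simp [Set.ncard_univ])

/-- Adding independent forms one at a time gives a strictly increasing chain of primes. -/
theorem finrank_span_le_height_formIdeal (s : Finset (Dual K (Fin (ℓ + 1) → K))) :
    (finrank K (Submodule.span K (s : Set (Dual K (Fin (ℓ + 1) → K)))) : ℕ∞) ≤
      (formIdeal (Submodule.span K (s : Set (Dual K (Fin (ℓ + 1) → K))))).height := by
  classical
  induction s using Finset.induction_on with
  | empty => rw [Finset.coe_empty, Submodule.span_empty, finrank_bot]; exact zero_le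
  | insert a s _ ih =>
    rw [Finset.coe_insert]
    by_cases ha : a ∈ Submodule.span K (s : Set (Dual K (Fin (ℓ + 1) → K)))
    · rwa [Submodule.span_insert_eq_span ha]
    · have hlt : formIdeal (Submodule.span K (s : Set (Dual K (Fin (ℓ + 1) → K)))) <
          formIdeal (Submodule.span K (insert a (s : Set (Dual K (Fin (ℓ + 1) → K))))) := by
        refine lt_of_le_of_ne (Ideal.span_mono (Set.image_mono
          (Submodule.span_mono (Set.subset_insert _ _)))) fun h => ha ?_
        rw [← formPoly_mem_formIdeal_iff, h]
        exact formPoly_mem_formIdeal (Submodule.subset_span (Set.mem_insert _ _))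
      have h1 : finrank K (Submodule.span K (insert a (s : Set (Dual K (Fin (ℓ + 1) → K))))) ≤
          finrank K (Submodule.span K (s : Set (Dual K (Fin (ℓ + 1) → K)))) + 1 := by
        rw [Submodule.span_insert, add_comm (finrank K _) 1]
        exact (Submodule.finrank_add_le_finrank_add_finrank _ _).trans
          (Nat.add_le_add_right ((finrank_span_le_card _).trans (by simp)) _)
      calc (finrank K (Submodule.span K (insert a (s : Set (Dual K (Fin (ℓ + 1) → K))))) : ℕ∞)
          ≤ finrank K (Submodule.span K (s : Set (Dual K (Fin (ℓ + 1) → K)))) + 1 := by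
            exact_mod_cast h1
        _ ≤ (formIdeal (Submodule.span K (s : Set (Dual K (Fin (ℓ + 1) → K))))).height + 1 := by
            gcongr
        _ ≤ _ := Ideal.height_add_one_le_of_lt_of_isPrime hlt

end Forms

/-! ### The Jacobian ideal of an arrangement -/

section Jacobian

variable {K : Type*} [Field K] {ℓ n : ℕ}

theorem pderiv_formPoly (φ : Dual K (Fin (ℓ + 1) → K)) (j : Fin (ℓ + 1)) :
    pderiv j (formPoly φ) = C (φ (Pi.single j 1)) := by
  simp [formPoly, pderiv_X, Pi.single_apply]

theorem pderiv_definingPoly (α : Fin n → Dual K (Fin (ℓ + 1) → K)) (j : Fin (ℓ + 1)) :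
    pderiv j (definingPoly α) = ∑ i, C (α i (Pi.single j 1)) * definingPolyDiv α i := by
  classical
  have : ∀ s : Finset (Fin n), pderiv j (∏ i ∈ s, formPoly (α i)) =
      ∑ i ∈ s, C (α i (Pi.single j 1)) * ∏ m ∈ s.erase i, formPoly (α m) := by
    intro s
    induction s using Finset.induction_on with
    | empty => simp
    | insert a s ha ih =>
      rw [Finset.prod_insert ha, pderiv_mul, ih, Finset.sum_insert ha, Finset.erase_insert ha,
        pderiv_formPoly, Finset.mul_sum]
      congr 1
      refine Finset.sum_congr rfl fun i hi => ?_
      rw [Finset.erase_insert_of_ne (by rintro rfl; exact ha hi),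
        Finset.prod_insert (fun h => ha (Finset.mem_of_mem_erase h))]
      ring
  exact this Finset.univ

/-- The directional derivative `D_v Q = ∑ α_i(v) Q / α_i` belongs to the Jacobian ideal. -/
theorem sum_apply_mul_definingPolyDiv_mem (α : Fin n → Dual K (Fin (ℓ + 1) → K))
    (v : Fin (ℓ + 1) → K) :
    ∑ i, C (α i v) * definingPolyDiv α i ∈ jacobianIdeal α := by
  have : ∑ i, C (α i v) * definingPolyDiv α i =
      ∑ j, C (v j) * pderiv j (definingPoly α) := by
    simp only [pderiv_definingPoly, Finset.mul_sum]
    rw [Finset.sum_comm]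
    refine Finset.sum_congr rfl fun i _ => ?_
    rw [dual_apply_eq_sum (α i) v, map_sum, Finset.sum_mul]
    refine Finset.sum_congr rfl fun j _ => ?_
    rw [C_mul]
    ring
  rw [this]
  exact sum_mem fun j _ => Ideal.mul_mem_left _ _ (Ideal.subset_span ⟨j, rfl⟩)

/-- By Euler's identity `∑ x_j ∂_j Q = n Q`. For `n = 0` the claim fails: then `Q = 1` and the
Jacobian ideal is zero. -/
theorem definingPoly_mem_jacobianIdeal [CharZero K] (α : Fin n → Dual K (Fin (ℓ + 1) → K))
    (hn : n ≠ 0) : definingPoly α ∈ jacobianIdeal α := by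
  have euler : ∑ j, X j * pderiv j (definingPoly α) = C (n : K) * definingPoly α := by
    simp only [pderiv_definingPoly, Finset.mul_sum]
    rw [Finset.sum_comm]
    have : ∀ i, ∑ j, X j * (C (α i (Pi.single j 1)) * definingPolyDiv α i) =
        definingPoly α := fun i => by
      rw [← formPoly_mul_definingPolyDiv α i, formPoly, Finset.sum_mul]
      exact Finset.sum_congr rfl fun j _ => by ring
    simp [this]
  have h : definingPoly α = C ((n : K)⁻¹) * ∑ j, X j * pderiv j (definingPoly α) := by
    rw [euler, ← mul_assoc, ← C_mul, inv_mul_cancel₀ (Nat.cast_ne_zero.mpr hn), C_1, one_mul]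
  rw [h]
  exact Ideal.mul_mem_left _ _
    (sum_mem fun j _ => Ideal.mul_mem_left _ _ (Ideal.subset_span ⟨j, rfl⟩))

theorem IsArrangement.notMem_span_singleton {α : Fin n → Dual K (Fin (ℓ + 1) → K)}
    (hα : IsArrangement α) {i j : Fin n} (hij : i ≠ j) : α j ∉ Submodule.span K {α i} := by
  intro h
  obtain ⟨a, ha⟩ := Submodule.mem_span_singleton.mp h
  have ha0 : a ≠ 0 := by
    rintro rfl
    exact hα.1 j (by rw [← ha, zero_smul])
  exact hα.2 i j hij (by rw [← ha, LinearMap.ker_smul _ _ ha0])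

/-- In a relation `∑ B_i Q / α_i = 0` each `B_i` is divisible by `α_i`: the prime `(α_i)` contains
all the other terms, but not `Q / α_i`. -/
theorem mem_formIdeal_of_sum_mul_definingPolyDiv_eq_zero [Infinite K]
    {α : Fin n → Dual K (Fin (ℓ + 1) → K)} (hα : IsArrangement α)
    {B : Fin n → MvPolynomial (Fin (ℓ + 1)) K} (hB : ∑ i, B i * definingPolyDiv α i = 0)
    (i : Fin n) : B i ∈ formIdeal (Submodule.span K {α i}) := by
  have hi : formPoly (α i) ∈ formIdeal (Submodule.span K {α i}) :=
    formPoly_mem_formIdeal (Submodule.mem_span_singleton_self _)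
  rw [← Finset.add_sum_erase _ _ (Finset.mem_univ i)] at hB
  have hmem : B i * definingPolyDiv α i ∈ formIdeal (Submodule.span K {α i}) := by
    rw [eq_neg_of_add_eq_zero_left hB]
    refine neg_mem (sum_mem fun j hj => Ideal.mul_mem_left _ _ ?_)
    exact Ideal.mem_of_dvd _ (Finset.dvd_prod_of_mem _
      (Finset.mem_erase.mpr ⟨(Finset.ne_of_mem_erase hj).symm, Finset.mem_univ i⟩)) hi
  refine ((formIdeal_isPrime _).mem_or_mem hmem).resolve_right fun h => ?_
  obtain ⟨j, hj, hji⟩ := (formIdeal_isPrime _).prod_mem_iff.mp h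
  exact hα.notMem_span_singleton (Finset.ne_of_mem_erase hj).symm
    (formPoly_mem_formIdeal_iff.mp hji)

/-- If `∑ c_i Q / α_i` belongs to the Jacobian ideal locally at a point `p`, then the scalars `c_i`
of the hyperplanes through `p` are the values of the forms `α_i` at a common vector. -/
theorem exists_eq_apply_of_mul_mem_jacobianIdeal [Infinite K]
    {α : Fin n → Dual K (Fin (ℓ + 1) → K)} (hα : IsArrangement α) {c : Fin n → K}
    {g : MvPolynomial (Fin (ℓ + 1)) K}
    (hg : g * ∑ i, C (c i) * definingPolyDiv α i ∈ jacobianIdeal α)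
    {p : Fin (ℓ + 1) → K} (hp : eval p g ≠ 0) :
    ∃ v, ∀ i, α i p = 0 → α i v = c i := by
  obtain ⟨h, hh⟩ := Ideal.mem_span_range_iff_exists_fun.mp hg
  let B : Fin n → MvPolynomial (Fin (ℓ + 1)) K := fun i =>
    (∑ j, h j * C (α i (Pi.single j 1))) - g * C (c i)
  have hB : ∑ i, B i * definingPolyDiv α i = 0 := by
    simp only [B, sub_mul, Finset.sum_sub_distrib, Finset.sum_mul]
    rw [Finset.sum_comm, sub_eq_zero, Finset.mul_sum] at *
    simp only [pderiv_definingPoly, Finset.mul_sum] at hh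
    simpa only [mul_assoc] using hh
  refine ⟨(eval p g)⁻¹ • fun j => eval p (h j), fun i hi => ?_⟩
  have hBi := eval_eq_zero_of_mem_formIdeal
    (mem_formIdeal_of_sum_mul_definingPolyDiv_eq_zero hα hB i) (x := p)
    ((Submodule.mem_dualCoannihilator p).mpr fun φ hφ => by
      obtain ⟨a, rfl⟩ := Submodule.mem_span_singleton.mp hφ
      simp [hi])
  have hsum : α i (fun j => eval p (h j)) = eval p g * c i := by
    simp only [B, map_sub, map_sum, map_mul, eval_C, sub_eq_zero] at hBi
    rw [dual_apply_eq_sum (α i), ← hBi]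
    exact Finset.sum_congr rfl fun j _ => mul_comm _ _
  rw [map_smul, hsum, smul_eq_mul, inv_mul_cancel_left₀ hp]

/-- The linear criterion for `∑ c_i Q / α_i` to lie in the codimension-`k` saturation. -/
theorem mem_codimSaturation_jacobianIdeal_iff [CharZero K]
    {α : Fin n → Dual K (Fin (ℓ + 1) → K)} (hα : IsArrangement α) (k : ℕ) (c : Fin n → K) :
    ∑ i, C (c i) * definingPolyDiv α i ∈ codimSaturation k (jacobianIdeal α) ↔
      ∀ F : Set (Fin n), rank α F ≤ k → ∃ v, ∀ i ∈ F, α i v = c i := by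
  classical
  rw [mem_codimSaturation_iff]
  constructor
  · intro h F hF
    obtain ⟨g, hgP, hg⟩ := h (formIdeal (Submodule.span K (α '' F))) inferInstance
      ((height_formIdeal_le _).trans (by exact_mod_cast hF))
    rw [mem_formIdeal_iff] at hgP
    push Not at hgP
    obtain ⟨p, hp, hpg⟩ := hgP
    obtain ⟨v, hv⟩ := exists_eq_apply_of_mul_mem_jacobianIdeal hα hg hpg
    exact ⟨v, fun i hi => hv i ((Submodule.mem_dualCoannihilator p).mp hp _
      (Submodule.subset_span ⟨i, hi, rfl⟩))⟩
  · intro h P hP hPk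
    -- For the empty arrangement `Q ∉ J`, but the sum is zero.
    obtain rfl | hn := eq_or_ne n 0
    · exact ⟨1, (Ideal.ne_top_iff_one P).mp hP.ne_top, by simp⟩
    let F : Finset (Fin n) := {i | formPoly (α i) ∈ P}
    have hFP : formIdeal (Submodule.span K (α '' F)) ≤ P := by
      rw [formIdeal_span_le_iff]
      rintro _ ⟨i, hi, rfl⟩
      simpa [F] using hi
    obtain ⟨v, hv⟩ := h F (by
      have := finrank_span_le_height_formIdeal (F.image α)
      rw [Finset.coe_image] at this
      exact_mod_cast (this.trans (Ideal.height_mono hFP)).trans hPk)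
    refine ⟨∏ i ∈ Finset.univ.filter (· ∉ F), formPoly (α i), fun hmem => ?_, ?_⟩
    · obtain ⟨i, hi, hiP⟩ := hP.prod_mem_iff.mp hmem
      simp [F] at hi
      exact hi hiP
    · have hsplit : ∑ i, C (c i) * definingPolyDiv α i =
          ∑ i, C (α i v) * definingPolyDiv α i +
            ∑ i, C (c i - α i v) * definingPolyDiv α i := by
        rw [← Finset.sum_add_distrib]
        exact Finset.sum_congr rfl fun i _ => by rw [C_sub]; ring
      rw [hsplit, mul_add]
      refine add_mem (Ideal.mul_mem_left _ _ (sum_apply_mul_definingPolyDiv_mem α v)) ?_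
      rw [Finset.mul_sum]
      refine sum_mem fun i _ => ?_
      by_cases hi : i ∈ F
      · simp [hv i hi]
      · refine Ideal.mem_of_dvd _ ?_ (definingPoly_mem_jacobianIdeal α hn)
        rw [← formPoly_mul_definingPolyDiv α i]
        exact mul_dvd_mul (Finset.dvd_prod_of_mem _ (by simpa using hi)) (dvd_mul_left _ _)

end Jacobian

/-! ### Linear algebra of perspective representations -/

section Perspective

variable {K : Type*} [Field K] {ℓ n : ℕ} {α : Fin n → Dual K (Fin (ℓ + 1) → K)}
  {α₀ : Dual K (Fin (ℓ + 1) → K)}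

theorem zeroSpace_eq_dualCoannihilator (F : Set (Fin n)) :
    zeroSpace α F = (Submodule.span K (α '' F)).dualCoannihilator := by
  ext x
  simp only [zeroSpace, Submodule.mem_iInf, LinearMap.mem_ker, Submodule.mem_dualCoannihilator]
  refine ⟨fun h φ hφ => ?_, fun h i hi => h _ (Submodule.subset_span ⟨i, hi, rfl⟩)⟩
  induction hφ using Submodule.span_induction with
  | mem _ hx => obtain ⟨i, hi, rfl⟩ := hx; exact h i hi
  | zero => rfl
  | add _ _ _ _ hx hy => simp [hx, hy]
  | smul _ _ _ hx => simp [hx]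

/-- General linear position says that `α₀` is no combination of the forms of a set of rank at most
`r`; the bound by `ℓ` makes the intersection of the hyperplanes nonempty in projective space. -/
theorem IsGenLinPos.notMem_span {r : ℕ} (h : IsGenLinPos α r α₀) {F : Set (Fin n)}
    (hr : rank α F ≤ r) (hℓ : rank α F ≤ ℓ) : α₀ ∉ Submodule.span K (α '' F) := by
  intro hmem
  -- The flat spanned by `F`.
  let F' : Set (Fin n) := {j | α j ∈ Submodule.span K (α '' F)}
  have hspan : Submodule.span K (α '' F') = Submodule.span K (α '' F) := by
    apply le_antisymm
    · rw [Submodule.span_le]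
      rintro _ ⟨j, hj, rfl⟩
      exact hj
    · exact Submodule.span_mono (Set.image_mono fun j hj => Submodule.subset_span ⟨j, hj, rfl⟩)
  refine h F' (fun j hj => by rwa [hspan] at hj) (by rwa [rank, hspan]) ?_ ?_
  · rw [zeroSpace_eq_dualCoannihilator, hspan]
    intro hbot
    have := Subspace.finrank_add_finrank_dualCoannihilator_eq (Submodule.span K (α '' F))
    rw [hbot, finrank_bot, finrank_fin_fun] at this
    rw [rank] at hℓ
    omega
  · rw [zeroSpace_eq_dualCoannihilator, hspan]
    exact fun x hx => (Submodule.mem_dualCoannihilator x).mp hx _ hmem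

theorem rank_le_card (s : Finset (Fin n)) : rank α s ≤ s.card := by
  classical
  rw [rank, ← Finset.coe_image]
  exact (finrank_span_finset_le_card _).trans Finset.card_image_le

theorem mem_span_singleton_of_ker_le {φ ψ : Dual K (Fin (ℓ + 1) → K)}
    (h : LinearMap.ker ψ ≤ LinearMap.ker φ) : φ ∈ Submodule.span K {ψ} := by
  rw [← Subspace.dualCoannihilator_dualAnnihilator_eq (W := Submodule.span K {ψ}),
    Submodule.mem_dualAnnihilator]
  exact fun x hx =>
    h ((Submodule.mem_dualCoannihilator x).mp hx ψ (Submodule.mem_span_singleton_self ψ))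

theorem isArrangement_add_smul (hα : IsArrangement α) (h : ∀ i j, α₀ ∉ Submodule.span K {α i, α j})
    (c : Fin n → K) : IsArrangement fun i => α i + c i • α₀ := by
  refine ⟨fun i hi => ?_, fun i j hij hker => ?_⟩
  · have hmem : c i • α₀ ∈ Submodule.span K {α i, α i} := by
      rw [eq_neg_of_add_eq_zero_right hi]
      exact neg_mem (Submodule.subset_span (by simp))
    have hc : c i = 0 := by
      by_contra hc
      exact h i i ((Submodule.smul_mem_iff _ hc).mp hmem)
    exact hα.1 i (by simpa [hc] using hi)
  · obtain ⟨a, ha⟩ := Submodule.mem_span_singleton.mp (mem_span_singleton_of_ker_le hker.le)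
    have heq : (a * c i - c j) • α₀ = α j - a • α i := by
      ext x
      have := LinearMap.congr_fun ha (Pi.single x 1)
      simp at this ⊢
      linear_combination this
    have hmem : (a * c i - c j) • α₀ ∈ Submodule.span K {α i, α j} := by
      rw [heq]
      exact sub_mem (Submodule.subset_span (by simp))
        (Submodule.smul_mem _ _ (Submodule.subset_span (by simp)))
    have hc : a * c i - c j = 0 := by
      by_contra hc
      exact h i j ((Submodule.smul_mem_iff _ hc).mp hmem)
    rw [hc, zero_smul, eq_comm, sub_eq_zero] at heq
    exact hα.notMem_span_singleton hij (Submodule.mem_span_singleton.mpr ⟨a, heq.symm⟩)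

theorem isPerspective_add_smul (hα : ∀ i, α i ≠ 0) (h : ∀ i, α₀ ∉ Submodule.span K {α i})
    (c : Fin n → K) : IsPerspective α α₀ fun i => α i + c i • α₀ := by
  refine ⟨fun i hker => h i (mem_span_singleton_of_ker_le hker.le), fun i hker => ?_, fun i => ?_⟩
  · obtain ⟨a, ha⟩ := Submodule.mem_span_singleton.mp (mem_span_singleton_of_ker_le hker.le)
    have heq : (1 - a * c i) • α₀ = a • α i := by
      ext x
      have := LinearMap.congr_fun ha (Pi.single x 1)
      simp at this ⊢
      linear_combination -this
    have hc : 1 - a * c i = 0 := by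
      by_contra hc
      exact h i ((Submodule.smul_mem_iff _ hc).mp
        (heq ▸ Submodule.smul_mem _ _ (Submodule.mem_span_singleton_self _)))
    rw [hc, zero_smul, eq_comm, smul_eq_zero] at heq
    simp [heq.resolve_right (hα i)] at hc
  · ext x
    simp only [Submodule.mem_inf, LinearMap.mem_ker]
    refine and_congr_left fun hx => ?_
    simp [hx]

/-- On a set where `c_i = α_i(v)`, the forms `α_i + c_i α₀` are the images of the `α_i` under the
linear map `φ ↦ φ + φ(v) α₀`, so dependent sets stay dependent. -/
theorem isWeakRep_add_smul {k : ℕ} {c : Fin n → K}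
    (h : ∀ F : Set (Fin n), rank α F ≤ k → ∃ v, ∀ i ∈ F, α i v = c i) :
    IsWeakRep α (k + 1) fun i => α i + c i • α₀ := by
  rintro s hs ⟨hcard, hβ⟩
  refine hs ⟨hcard, ?_⟩
  by_contra hdep
  have hrank : rank α s ≤ k := by
    rw [LinearIndepOn, linearIndependent_iff_card_le_finrank_span, not_le, Set.finrank,
      ← Set.image_eq_range] at hdep
    rw [rank]
    simp at hdep
    omega
  obtain ⟨v, hv⟩ := h s hrank
  let T : Dual K (Fin (ℓ + 1) → K) →ₗ[K] Dual K (Fin (ℓ + 1) → K) :=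
    LinearMap.id + (Dual.eval K _ v).smulRight α₀
  exact hdep (LinearIndepOn.of_comp T (hβ.congr fun i hi => by simp [T, hv i hi]))

theorem exists_forall_apply_eq {B : Set (Fin n)} (hB : LinearIndepOn K α B) (c : Fin n → K) :
    ∃ v, ∀ i ∈ B, α i v = c i := by
  let g := (Basis.span hB).constr K fun i : B => c i
  obtain ⟨G, hG⟩ := LinearMap.exists_extend g
  refine ⟨(evalEquiv K _).symm G, fun i hi => ?_⟩
  rw [apply_evalEquiv_symm_apply]
  have hb : (Basis.span hB ⟨i, hi⟩ : Dual K (Fin (ℓ + 1) → K)) = α i :=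
    congrArg Subtype.val (Basis.span_apply hB ⟨i, hi⟩)
  rw [← hb]
  refine (LinearMap.congr_fun hG (Basis.span hB ⟨i, hi⟩)).trans ?_
  exact Basis.constr_basis ..

/-- If the `α_i + c_i α₀` weakly represent the matroid of `α` up to rank `k + 1`, then on each set
of rank at most `k` the scalars `c_i` are the values of the `α_i` at a common vector. The vector is
fixed by the values on a basis of the set, and each further element forms with the basis a dependent
set of at most `k + 1` elements. -/
theorem exists_of_isWeakRep {k : ℕ} (hkℓ : k ≤ ℓ) (hgen : IsGenLinPos α (k + 1) α₀)
    {c : Fin n → K} (h : IsWeakRep α (k + 1) fun i => α i + c i • α₀)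
    (F : Set (Fin n)) (hF : rank α F ≤ k) : ∃ v, ∀ i ∈ F, α i v = c i := by
  classical
  obtain ⟨B', hBF, -, hspan, hB⟩ :=
    exists_linearIndepOn_extension (linearIndepOn_empty K α) (Set.empty_subset F)
  obtain ⟨B, rfl⟩ : ∃ B : Finset (Fin n), (B : Set (Fin n)) = B' :=
    ⟨B'.toFinite.toFinset, by simp⟩
  have hspanF : Submodule.span K (α '' F) = Submodule.span K (α '' B) :=
    le_antisymm (Submodule.span_le.mpr hspan) (Submodule.span_mono (Set.image_mono hBF))
  have hcard : B.card ≤ k := by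
    have := finrank_span_eq_card (R := K) (b := fun i : (B : Set (Fin n)) => α i) hB
    rw [← Set.image_eq_range, ← hspanF] at this
    rw [rank, this] at hF
    simpa using hF
  have hα₀F : α₀ ∉ Submodule.span K (α '' B) := by
    rw [← hspanF]
    exact hgen.notMem_span (by omega) (by omega)
  obtain ⟨v, hv⟩ := exists_forall_apply_eq hB c
  refine ⟨v, fun j hj => ?_⟩
  by_cases hjB : j ∈ B
  · exact hv j hjB
  have hjspan : α j ∈ Submodule.span K (α '' B) := hspan ⟨j, hj, rfl⟩
  let T : Dual K (Fin (ℓ + 1) → K) →ₗ[K] Dual K (Fin (ℓ + 1) → K) :=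
    LinearMap.id + (Dual.eval K _ v).smulRight α₀
  have hT : ∀ φ, T φ = φ + φ v • α₀ := fun φ => by simp [T]
  have hTB : Set.EqOn (fun i => α i + c i • α₀) (T ∘ α) B := fun i hi => by simp [hT, hv i hi]
  -- `α₀` is transversal to the span of the forms in `F`.
  have key : ∀ φ ∈ Submodule.span K (α '' B), ∀ a : K, φ + a • α₀ = 0 → φ = 0 ∧ a = 0 := by
    intro φ hφ a ha
    have ha0 : a = 0 := by
      by_contra ha0
      refine hα₀F ((Submodule.smul_mem_iff _ ha0).mp ?_)
      rw [eq_neg_of_add_eq_zero_right ha]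
      exact neg_mem hφ
    exact ⟨by simpa [ha0] using ha, ha0⟩
  have hβB : LinearIndepOn K (fun i => α i + c i • α₀) (B : Set (Fin n)) := by
    refine (hB.map_injOn T fun φ hφ ψ hψ hφψ => ?_).congr hTB.symm
    rw [← sub_eq_zero, ← map_sub, hT] at hφψ
    exact sub_eq_zero.mp (key _ (sub_mem hφ hψ) _ hφψ).1
  have hdep : ¬ TruncIndep α (k + 1) (insert j B) := by
    rintro ⟨-, hind⟩
    rw [Finset.coe_insert, linearIndepOn_insert (by simpa using hjB)] at hind
    exact hind.2 hjspan
  have hβdep := h _ hdep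
  rw [TruncIndep, Finset.card_insert_of_notMem hjB, Finset.coe_insert,
    linearIndepOn_insert (by simpa using hjB)] at hβdep
  have hβj : α j + c j • α₀ ∈ Submodule.span K (T '' (α '' B)) := by
    rw [← Set.image_comp, ← hTB.image_eq]
    by_contra hβj
    exact hβdep ⟨by omega, hβB, hβj⟩
  rw [← Submodule.map_span] at hβj
  obtain ⟨φ, hφ, hφj⟩ := hβj
  rw [hT] at hφj
  obtain ⟨h1, h2⟩ := key (α j - φ) (sub_mem hjspan hφ) (c j - φ v) (by
    ext x
    have := LinearMap.congr_fun hφj (Pi.single x 1)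
    simp at this ⊢
    linear_combination -this)
  rw [sub_eq_zero.mp h1, sub_eq_zero.mp h2]

end Perspective

end WeakPRep

theorem theorem5p4 {K : Type*} [Field K] [CharZero K] {ℓ n : ℕ} (hℓ : 2 ≤ ℓ)
    (α : Fin n → Module.Dual K (Fin (ℓ + 1) → K)) (hα : WeakPRep.IsArrangement α)
    (k : ℕ) (hk : 1 ≤ k) (hkℓ : k ≤ ℓ)
    (α₀ : Module.Dual K (Fin (ℓ + 1) → K)) (hα₀ : α₀ ≠ 0)
    (hgen : WeakPRep.IsGenLinPos α (k + 1) α₀)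
    (c : Fin n → K) :
    (∑ i, MvPolynomial.C (c i) * WeakPRep.definingPolyDiv α i) ∈
        WeakPRep.codimSaturation k (WeakPRep.jacobianIdeal α) ↔
      WeakPRep.IsWeakPRepFrom α (k + 1) α₀ (fun i => α i + c i • α₀) := by
  classical
  rw [WeakPRep.mem_codimSaturation_jacobianIdeal_iff hα]
  have hpair : ∀ i j, α₀ ∉ Submodule.span K {α i, α j} := fun i j => by
    have hcard := (WeakPRep.rank_le_card (α := α) {i, j}).trans Finset.card_le_two
    have := hgen.notMem_span (hcard.trans (by omega)) (hcard.trans hℓ)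
    rwa [Finset.coe_insert, Finset.coe_singleton, Set.image_pair] at this
  refine ⟨fun h => ⟨WeakPRep.isArrangement_add_smul hα hpair c, hgen,
    WeakPRep.isPerspective_add_smul hα.1 (fun i => by simpa using hpair i i) c,
    WeakPRep.isWeakRep_add_smul h⟩, fun h => WeakPRep.exists_of_isWeakRep hkℓ hgen h.2.2.2⟩
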